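/- Let $\mathcal H$ be a separable infinite-dimensional complex Hilbert space, let $\mathcal J$ be an operator ideal, that is, a nonzero proper two-sided ideal of $\mathcal B(\mathcal H)$ (not necessarily closed), and let $p,q\in\mathcal B(\mathcal H)$ be (orthogonal) projections. Write $p^\perp=1-p$, $q^\perp=1-q$, and let $p\wedge q$ be the projection onto $p\mathcal H\cap q\mathcal H$; a projection is finite if its range is finite-dimensional. Put $p_0:=p-p\wedge q-p\wedge q^\perp$ and $q_0:=q-p\wedge q-p^\perp\wedge q$ (the generic parts of $p$ and $q$), and let $s:=(q_0\,p_0^\perp\,q_0)^{1/2}$, where $p_0^\perp=1-p_0$; this is an operator on $q_0\mathcal H$, regarded as an operator on $\mathcal H$ that vanishes on $(q_0\mathcal H)^\perp$. The pair $(p,q)$ is called a Fredholm pair if the operator $q|_{p\mathcal H}:p\mathcal H\to q\mathcal H$ is Fredholm, and then its essential codimension is $[p:q]:=\operatorname{ind}(q|_{p\mathcal H})=\dim\ker(q|_{p\mathcal H})-\dim\operatorname{coker}(q|_{p\mathcal H})$. (i) $p-q\in\mathcal J$ if and only if $p^\perp\wedge q$ and $p\wedge q^\perp$ are finite and $s\in\mathcal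 J$. (ii) If $p-q\in\mathcal J$, then $(p,q)$ is a Fredholm pair, and $[p:q]=0$ if and only if there is a unitary $u\in 1+\mathcal J$ such that $p=uqu^*$. -/

import Mathlib

noncomputable section

namespace ProjectionPair

variable {H : Type*} [NormedAddCommGroup H] [InnerProductSpace ℂ H] [CompleteSpace H]

/-- The meet `p ∧ q` of two projections: the orthogonal projection onto `ran p ∩ ran q`.
The ranges of projections are closed, so that for projections the closure changes nothing;
it only serves to make the definition total. -/
def meet (p q : H →L[ℂ] H) : H →L[ℂ] H :=
  (p.range ⊓ q.range).topologicalClosure.starProjection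

/-- The complement `p^⊥ = 1 - p`. -/
def perp (p : H →L[ℂ] H) : H →L[ℂ] H := 1 - p

/-- A projection is finite in `B(H)` if its range is finite-dimensional. -/
def IsFiniteProj (p : H →L[ℂ] H) : Prop := FiniteDimensional ℂ p.range

/-- The generic part `p₀ = p - p ∧ q - p ∧ q^⊥` of `p` relative to `q`;
the generic part `q₀ = q - q ∧ p - q ∧ p^⊥` of `q` relative to `p` is `genericPart q p`. -/
def genericPart (p q : H →L[ℂ] H) : H →L[ℂ] H := p - meet p q - meet p (perp q)

/-- The operator `s = (q₀ p₀^⊥ q₀)^{1/2}` of the pair `p, q`. It lives on `q₀H`, and is regarded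
as an operator on `H` that vanishes on `(q₀H)^⊥`. (As `q₀ ≤ p₀ ∨ q₀`, it makes no difference
whether `p₀^⊥` is taken in `H` or in `(p₀ ∨ q₀)H`.) -/
def genericSine (p q : H →L[ℂ] H) : H →L[ℂ] H :=
  CFC.sqrt (genericPart q p * perp (genericPart p q) * genericPart q p)

/-- The operator `q|_{pH} : pH → qH`. -/
def restr (p q : H →L[ℂ] H) : p.range →L[ℂ] q.range :=
  (q.comp p.range.subtypeL).codRestrict q.range (fun x => ⟨(x : H), rfl⟩)

/-- `(p, q)` is a Fredholm pair if `q|_{pH} : pH → qH` is a Fredholm operator. -/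
def IsFredholmPair (p q : H →L[ℂ] H) : Prop := (restr p q).IsFredholm

/-- The essential codimension `[p : q]`, the index (dimension of the kernel minus dimension of the
cokernel) of `q|_{pH} : pH → qH`. It is meaningful for Fredholm pairs only. -/
def essCodim (p q : H →L[ℂ] H) : ℤ := (restr p q).toLinearMap.index

end ProjectionPair

end

/-! Everything is governed by `D = (p - q)²`, which commutes with `p` and `q` and satisfies `q(1 -
D) = qpq`, `p(1 - D) = pqp`. A continuous cut at height 1/2 gives `F = (D - 1/2)₊` such that `1 - D
+ F` is invertible, with inverse `N` commuting with `p` and `q`. Compactness is replaced by one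
fact: an element of a proper ideal has a finite-dimensional fixed space, so `F` has finite rank as
soon as `D` lies in `J`.

(i) By Douglas factorization an ideal sees only the norms `‖Tx‖`, so `s` may be replaced by `p^⊥q -
p^⊥ ∧ q`. The point is to recover the other half `pq^⊥` of `p - q = pq^⊥ - p^⊥q`: its product with
`1 - D` lies in `J`, its product with `F` has finite rank, and `N` reassembles it (`mul_perp_mem`).

(ii) `pN` inverts `q|_{pH}` up to finite rank, and the index is `dim(p ∧ q^⊥) - dim(p^⊥ ∧ q)`. If it
vanishes, a partial isometry `W` from `p^⊥ ∧ q` onto `p ∧ q^⊥` completes `X = pq + p^⊥q^⊥` to a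
normal invertible `Y = X + W + W*` in `1 + J` with `Yq = pY`; its unitary part is `u`. Conversely,
for `u` in `1 + J`, the map `q|_{pH} ∘ u|_{qH}` is the identity plus a strict contraction plus a
finite rank operator, so its index is zero, and `u` maps `qH` bijectively onto `pH`. -/

open scoped InnerProductSpace

/-! ### Index of finite rank perturbations, algebraically. -/

namespace LinearMap

variable {k M N : Type*} [Field k] [AddCommGroup M] [Module k M] [AddCommGroup N] [Module k N]

/-- A finite rank perturbation of the identity has finite-dimensional kernel and cokernel,
and index zero. -/
theorem index_id_add_of_finite_range (b : M →ₗ[k] M) (hb : FiniteDimensional k b.range) :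
    FiniteDimensional k (id + b).ker ∧ FiniteDimensional k (M ⧸ (id + b).range) ∧
      (id + b).index = 0 := by
  set f : M →ₗ[k] M := id + b with hf
  have hfb : ∀ x, f x = x + b x := fun x => rfl
  -- `f` induces the identity on `M / ran b`, so its kernel and cokernel are those of its
  -- restriction `g` to the finite-dimensional space `ran b`.
  have hR : ∀ x ∈ b.range, f x ∈ b.range := fun x hx => by
    rw [hfb]; exact add_mem hx ⟨x, rfl⟩
  let g : b.range →ₗ[k] b.range := f.restrict hR
  have hg : g.index = 0 := by rw [index_eq_of_finiteDimensional]; simp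
  have hker : f.ker ≤ b.range := fun x hx => by
    have h : x + b x = 0 := hx
    rw [eq_neg_of_add_eq_zero_left h]
    exact neg_mem ⟨x, rfl⟩
  have hkfin : FiniteDimensional k f.ker := Submodule.finiteDimensional_of_le hker
  have hkereq : Module.finrank k g.ker = Module.finrank k f.ker := by
    have : g.ker = f.ker.comap b.range.subtype := by
      ext x; simp [g, Subtype.ext_iff]
    rw [this]
    exact (Submodule.comapSubtypeEquivOfLe hker).finrank_eq
  let φ : b.range →ₗ[k] M ⧸ f.range := f.range.mkQ ∘ₗ b.range.subtype
  have hφs : Function.Surjective φ := by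
    intro y
    obtain ⟨x, rfl⟩ := Submodule.mkQ_surjective _ y
    refine ⟨-⟨b x, x, rfl⟩, ?_⟩
    have h : -b x - x ∈ f.range := ⟨-x, by simp [hfb]; abel⟩
    simpa [φ] using (Submodule.Quotient.eq f.range).2 h
  have hφk : φ.ker = g.range := by
    ext ⟨x, hx⟩
    simp only [φ, mem_ker, coe_comp, Function.comp_apply, Submodule.subtype_apply,
      Submodule.mkQ_apply, Submodule.Quotient.mk_eq_zero, mem_range]
    constructor
    · rintro ⟨y, hy⟩
      have hyR : y ∈ b.range := by
        have : y = x - b y := by rw [← hy, hfb]; abel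
        rw [this]; exact sub_mem hx ⟨y, rfl⟩
      exact ⟨⟨y, hyR⟩, Subtype.ext hy⟩
    · rintro ⟨y, hy⟩
      exact ⟨y, congrArg Subtype.val hy⟩
  let e := (Submodule.quotEquivOfEq _ _ hφk.symm).trans (φ.quotKerEquivOfSurjective hφs)
  have hcfin : FiniteDimensional k (M ⧸ f.range) := Module.Finite.equiv e
  refine ⟨hkfin, hcfin, ?_⟩
  rw [index_eq_finrank_sub] at hg ⊢
  rw [← hkereq, ← e.finrank_eq, hg]

/-- A finite rank perturbation of a linear equivalence has index zero. -/
theorem index_equiv_add_of_finite_range (e : M ≃ₗ[k] N) (b : M →ₗ[k] N)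
    (hb : FiniteDimensional k b.range) :
    (e.toLinearMap + b).index = 0 := by
  have hc : FiniteDimensional k (e.symm.toLinearMap ∘ₗ b).range := by
    rw [range_comp]; infer_instance
  obtain ⟨h1, h2, h3⟩ := index_id_add_of_finite_range (e.symm.toLinearMap ∘ₗ b) hc
  have h : e.toLinearMap + b = e.toLinearMap ∘ₗ (id + e.symm.toLinearMap ∘ₗ b) := by
    ext x; simp
  have : FiniteDimensional k e.toLinearMap.ker := by
    rw [LinearEquiv.ker]; infer_instance
  have : FiniteDimensional k (N ⧸ e.toLinearMap.range) := by
    rw [LinearEquiv.range]; infer_instance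
  rw [h, index_comp, h3, LinearEquiv.index_eq_zero, add_zero]

end LinearMap

/-! ### Douglas factorization and the spectral cut. -/

namespace ContinuousLinearMap

variable {H : Type*} [NormedAddCommGroup H] [InnerProductSpace ℂ H] [CompleteSpace H]

/-- Douglas factorization: an operator dominated by `B` is a left multiple of `B`. -/
theorem exists_eq_mul_of_norm_le (A B : H →L[ℂ] H) (h : ∀ x, ‖A x‖ ≤ ‖B x‖) :
    ∃ K : H →L[ℂ] H, A = K * B := by
  let U := B.range.topologicalClosure
  have hU : ∀ x, B x ∈ U := fun x => Submodule.le_topologicalClosure _ ⟨x, rfl⟩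
  let e : H →ₗ[ℂ] U := B.toLinearMap.codRestrict U hU
  have hd : DenseRange e := by
    rw [DenseRange, dense_iff_closure_eq, Set.eq_univ_iff_forall]
    rintro ⟨x, hx⟩
    rw [closure_subtype]
    have hx' : x ∈ closure (B.range : Set H) := hx
    convert hx'
    ext y
    simp [e, Subtype.ext_iff]
    grind
  -- The bound makes `Bx ↦ Ax` a well-defined contraction on `ran B`; it extends to the closure, and
  -- by zero to the orthogonal complement.
  let K := A.toLinearMap.extendOfNorm e
  refine ⟨K ∘L U.orthogonalProjectionOnto, ?_⟩
  ext x
  have h1 : U.orthogonalProjectionOnto (B x) = e x :=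
    U.orthogonalProjectionOnto_mem_subspace_eq_self ⟨B x, hU x⟩
  have h2 : K (e x) = A x := LinearMap.extendOfNorm_eq hd ⟨1, fun x => by simpa [e] using h x⟩ x
  simp [h1, h2]

theorem norm_apply_eq_of_star_mul_self_eq {A B : H →L[ℂ] H} (h : star A * A = star B * B) (x : H) :
    ‖A x‖ = ‖B x‖ := by
  have h' := apply_norm_sq_eq_inner_adjoint_left A x
  have h2 := apply_norm_sq_eq_inner_adjoint_left B x
  rw [star_eq_adjoint, star_eq_adjoint] at h
  have h3 : (adjoint A ∘L A) = adjoint B ∘L B := h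
  rw [h3, ← h2] at h'
  exact (sq_eq_sq₀ (norm_nonneg _) (norm_nonneg _)).1 h'

/-- Cutting a positive operator `A` at height `1/2`: `F` is the part above, `A - F = A R` the
part below. -/
theorem exists_spectral_cut (A : H →L[ℂ] H) (hA : 0 ≤ A) :
    ∃ F R : H →L[ℂ] H, (∀ b, Commute A b → Commute F b) ∧ (∀ b, Commute A b → Commute R b) ∧
      A * R = A - F ∧ ‖A - F‖ ≤ 1 / 2 ∧ IsSelfAdjoint R ∧ ‖R‖ ≤ 1 ∧ 1 - R = (R + R) * F ∧
      F = (R + R) * (A * F) := by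
  have hsa : IsSelfAdjoint A := IsSelfAdjoint.of_nonneg hA
  have hsp : ∀ t ∈ spectrum ℝ A, 0 ≤ t := fun t ht => spectrum_nonneg_of_nonneg hA ht
  -- Here `r` is 1 below 1/2 and `1/(2t)` above, so `t r = min(t, 1/2) = t - f` and `2 r t = 1`
  -- wherever `f ≠ 0`. Continuity of both avoids spectral projections.
  let f : ℝ → ℝ := fun t => max (t - 1 / 2) 0
  let r : ℝ → ℝ := fun t => (2 * max t (1 / 2))⁻¹
  have hm : ∀ t : ℝ, 2 * max t (1 / 2) ≠ 0 := fun t =>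
    (mul_pos two_pos (lt_max_of_lt_right (by norm_num))).ne'
  have hf : Continuous f := by fun_prop
  have hr : Continuous r := by
    refine Continuous.inv₀ (by fun_prop) hm
  have hid : cfc (fun t : ℝ => t) A = A := cfc_id' ℝ A
  have hone : cfc (fun _ : ℝ => (1 : ℝ)) A = 1 := cfc_const_one ℝ A
  have e1 : A - cfc f A = cfc (fun t => t - f t) A := by
    rw [cfc_sub (fun t => t) f A continuousOn_id hf.continuousOn, hid]
  have e2 : A * cfc r A = cfc (fun t => t * r t) A := by
    rw [cfc_mul (fun t => t) r A continuousOn_id hr.continuousOn, hid]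
  have e3 : 1 - cfc r A = cfc (fun t => 1 - r t) A := by
    rw [cfc_sub (fun _ => 1) r A continuousOn_const hr.continuousOn, hone]
  have e4 : cfc r A * cfc f A = cfc (fun t => r t * f t) A := by
    rw [cfc_mul r f A hr.continuousOn hf.continuousOn]
  have e5 : A * cfc f A = cfc (fun t => t * f t) A := by
    rw [cfc_mul (fun t => t) f A continuousOn_id hf.continuousOn, hid]
  have e6 : cfc r A * (A * cfc f A) = cfc (fun t => r t * (t * f t)) A := by
    rw [e5, cfc_mul r (fun t => t * f t) A hr.continuousOn (continuous_id.mul hf).continuousOn]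
  refine ⟨cfc f A, cfc r A, ?_, ?_, ?_, ?_, ?_, ?_, ?_, ?_⟩
  · exact fun b hb => hb.cfc_real f
  · exact fun b hb => hb.cfc_real r
  · rw [e1, e2]
    refine cfc_congr fun t ht => ?_
    have := hm t
    simp only [r, f]
    rcases le_total t (1 / 2) with h | h
    · rw [max_eq_right h, max_eq_right (by linarith)]; norm_num
    · rw [max_eq_left h, max_eq_left (by linarith)]
      have : t ≠ 0 := by linarith
      field_simp; ring
  · rw [e1]
    refine norm_cfc_le (by norm_num) fun t ht => ?_
    have := hsp t ht
    simp only [f]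
    rcases le_total t (1 / 2) with h | h
    · rw [max_eq_right (by linarith), sub_zero, Real.norm_of_nonneg this]; exact h
    · rw [max_eq_left (by linarith)]; norm_num
  · exact cfc_predicate r A
  · refine norm_cfc_le (by norm_num) fun t ht => ?_
    simp only [r]
    rw [norm_inv]
    refine inv_le_one_of_one_le₀ ?_
    rw [Real.norm_eq_abs]
    refine le_trans ?_ (le_abs_self _)
    linarith [le_max_right t (1 / 2)]
  · rw [e3, ← two_smul ℝ, smul_mul_assoc, e4, ← cfc_const_mul 2 (fun t => r t * f t) A (hr.mul hf).continuousOn]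
    refine cfc_congr fun t ht => ?_
    simp only [r, f]
    rcases le_total t (1 / 2) with h | h
    · rw [max_eq_right h, max_eq_right (by linarith)]; norm_num
    · rw [max_eq_left h, max_eq_left (by linarith)]
      have : t ≠ 0 := by linarith
      field_simp
  · rw [← two_smul ℝ, smul_mul_assoc, e6, ← cfc_const_mul 2 (fun t => r t * (t * f t)) A (hr.mul (continuous_id.mul hf)).continuousOn]
    refine cfc_congr fun t ht => ?_
    simp only [r, f]
    rcases le_total t (1 / 2) with h | h
    · rw [max_eq_right h, max_eq_right (by linarith)]; norm_num
    · rw [max_eq_left h, max_eq_left (by linarith)]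
      have : t ≠ 0 := by linarith
      field_simp

end ContinuousLinearMap

/-! ### Isometric embeddings of separable Hilbert spaces. -/

namespace Orthonormal

/-- An orthonormal family in a separable inner product space is countable. -/
theorem countable_of_separableSpace {ι E : Type*} [NormedAddCommGroup E] [InnerProductSpace ℂ E]
    [TopologicalSpace.SeparableSpace E] {v : ι → E} (hv : Orthonormal ℂ v) : Countable ι := by
  have hd : Pairwise fun i j => Disjoint (Metric.ball (v i) (1 / 2)) (Metric.ball (v j) (1 / 2)) := by
    intro i j hij
    refine Metric.ball_disjoint_ball ?_
    have h : ‖v i - v j‖ ^ 2 = 2 := by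
      rw [@norm_sub_sq ℂ, hv.1 i, hv.1 j, hv.2 hij]; norm_num
    rw [dist_eq_norm]
    nlinarith [norm_nonneg (v i - v j)]
  exact hd.countable_of_isOpen_disjoint (fun _ => Metric.isOpen_ball)
    (fun i => ⟨v i, Metric.mem_ball_self (by norm_num)⟩)

end Orthonormal

/-- A separable Hilbert space embeds isometrically into every infinite-dimensional one. -/
theorem exists_linearIsometry_of_infinite_dimensional {E F : Type*}
    [NormedAddCommGroup E] [InnerProductSpace ℂ E] [CompleteSpace E]
    [TopologicalSpace.SeparableSpace E]
    [NormedAddCommGroup F] [InnerProductSpace ℂ F] [CompleteSpace F]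
    (hF : ¬ FiniteDimensional ℂ F) : Nonempty (E →ₗᵢ[ℂ] F) := by
  obtain ⟨s, b, -⟩ := exists_hilbertBasis ℂ E
  obtain ⟨t, d, -⟩ := exists_hilbertBasis ℂ F
  have hs : Countable s := b.orthonormal.countable_of_separableSpace
  have ht : Infinite t := by
    by_contra h
    rw [not_infinite_iff_finite] at h
    have := Fintype.ofFinite t
    exact hF d.toOrthonormalBasis.toBasis.finiteDimensional_of_finite
  obtain ⟨f, hf⟩ := hs
  let g : s → t := fun x => Infinite.natEmbedding t (f x)
  have hg : Function.Injective g := (Infinite.natEmbedding t).injective.comp hf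
  have ho : Orthonormal ℂ (d ∘ g) := d.orthonormal.comp g hg
  exact ⟨ho.orthogonalFamily.linearIsometry.comp b.repr.toLinearIsometry⟩

/-! ### Ideals of `B(H)`. -/

namespace TwoSidedIdeal

open ContinuousLinearMap

variable {H : Type*} [NormedAddCommGroup H] [InnerProductSpace ℂ H] [CompleteSpace H]

theorem mem_of_norm_le (J : TwoSidedIdeal (H →L[ℂ] H)) {A B : H →L[ℂ] H} (hB : B ∈ J)
    (h : ∀ x, ‖A x‖ ≤ ‖B x‖) : A ∈ J := by
  obtain ⟨K, rfl⟩ := exists_eq_mul_of_norm_le A B h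
  exact J.mul_mem_left _ _ hB

/-- Every ideal of `B(H)` is self-adjoint. -/
theorem star_mem_of_mem (J : TwoSidedIdeal (H →L[ℂ] H)) {T : H →L[ℂ] H} (hT : T ∈ J) :
    star T ∈ J := by
  have hc : IsSelfAdjoint (CFC.sqrt (star T * T)) := IsSelfAdjoint.of_nonneg (CFC.sqrt_nonneg _)
  have h : star (CFC.sqrt (star T * T)) * CFC.sqrt (star T * T) = star T * T := by
    rw [hc.star_eq, CFC.sqrt_mul_sqrt_self _ (star_mul_self_nonneg T)]
  have hn := norm_apply_eq_of_star_mul_self_eq h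
  obtain ⟨L, hL⟩ := exists_eq_mul_of_norm_le T _ fun x => (hn x).ge
  -- With `T = L|T|` one has `T* = |T|L*`, and `|T|` is in `J` because it has the same norms as `T`.
  rw [hL, star_mul, hc.star_eq]
  exact J.mul_mem_right _ _ (J.mem_of_norm_le hT fun x => (hn x).le)

omit [CompleteSpace H] in
/-- A nonzero ideal of `B(H)` contains all finite rank operators. -/
theorem mem_of_finite_range (J : TwoSidedIdeal (H →L[ℂ] H)) (hJ : J ≠ ⊥) {b : H →L[ℂ] H}
    (hb : FiniteDimensional ℂ b.range) : b ∈ J := by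
  obtain ⟨T, hT, hT0⟩ : ∃ T ∈ J, T ≠ 0 := by
    by_contra! h
    refine hJ (TwoSidedIdeal.ext fun x => ⟨fun hx => ?_, fun hx => ?_⟩)
    · rw [h x hx]; exact zero_mem _
    · rw [TwoSidedIdeal.mem_bot] at hx
      rw [hx]; exact zero_mem _
  obtain ⟨x, hx⟩ : ∃ x, T x ≠ 0 := by
    by_contra! h
    exact hT0 (ContinuousLinearMap.ext h)
  have hr : ∀ a c : H, InnerProductSpace.rankOne ℂ a c ∈ J := by
    intro a c
    have hne : ⟪T x, T x⟫_ℂ ≠ 0 := inner_self_ne_zero.2 hx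
    have : InnerProductSpace.rankOne ℂ a c =
        InnerProductSpace.rankOne ℂ ((⟪T x, T x⟫_ℂ)⁻¹ • a) (T x) * T *
          InnerProductSpace.rankOne ℂ x c := by
      ext y
      change ⟪c, y⟫_ℂ • a = ⟪T x, T (⟪c, y⟫_ℂ • x)⟫_ℂ • (⟪T x, T x⟫_ℂ)⁻¹ • a
      rw [map_smul, inner_smul_right, smul_smul, mul_assoc, mul_inv_cancel₀ hne, mul_one]
    rw [this]
    exact J.mul_mem_right _ _ (J.mul_mem_left _ _ hT)
  have hP : b.range.starProjection ∈ J := by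
    rw [OrthonormalBasis.starProjection_eq_sum_rankOne (stdOrthonormalBasis ℂ b.range)]
    exact sum_mem fun i _ => hr _ _
  have : b = b.range.starProjection * b := by
    ext y
    exact (Submodule.starProjection_eq_self_iff.2 (⟨y, rfl⟩ : b y ∈ b.range)).symm
  rw [this]
  exact J.mul_mem_right _ _ hP

/-- The fixed space of an element of a proper ideal is finite-dimensional. -/
theorem finiteDimensional_ker_one_sub [TopologicalSpace.SeparableSpace H]
    (J : TwoSidedIdeal (H →L[ℂ] H)) (hJ : J ≠ ⊤) {K : H →L[ℂ] H} (hK : K ∈ J) :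
    FiniteDimensional ℂ (1 - K).ker := by
  by_contra hM
  have : CompleteSpace (1 - K).ker := (1 - K).isClosed_ker.completeSpace_coe
  -- An isometry `V` of `H` into the fixed space of `K` would give `V*KV = 1`, an element of `J`.
  obtain ⟨V⟩ := exists_linearIsometry_of_infinite_dimensional (E := H) hM
  let V' : H →L[ℂ] H := (1 - K).ker.subtypeL ∘L V.toContinuousLinearMap
  have h1 : star V' * V' = 1 := by
    have := (ContinuousLinearMap.norm_map_iff_adjoint_comp_self V').1 fun x => V.norm_map x
    exact this
  have h2 : K * V' = V' := by
    ext x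
    have : (1 - K) (V x : H) = 0 := (V x).2
    exact (sub_eq_zero.1 this).symm
  refine hJ (eq_top_iff.2 fun x _ => ?_)
  have h3 : x * (star V' * (K * V')) ∈ J :=
    J.mul_mem_left _ _ (J.mul_mem_left _ _ (J.mul_mem_right _ _ hK))
  rwa [h2, h1, mul_one] at h3

/-- The range of `b` consists of fixed vectors of `K`. This is the device by which the cut-off parts
`F` are shown to have finite rank. -/
theorem finiteDimensional_range_of_mul_eq [TopologicalSpace.SeparableSpace H]
    (J : TwoSidedIdeal (H →L[ℂ] H)) (hJ : J ≠ ⊤) {K b : H →L[ℂ] H} (hK : K ∈ J)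
    (h : K * b = b) : FiniteDimensional ℂ b.range := by
  have := J.finiteDimensional_ker_one_sub hJ hK
  refine Submodule.finiteDimensional_of_le (S₂ := (1 - K).ker) ?_
  rintro _ ⟨y, rfl⟩
  have : K (b y) = b y := congrArg (fun T : H →L[ℂ] H => T y) h
  exact sub_eq_zero.2 this.symm

/-- Elements of a proper ideal are finite rank perturbations of strict contractions. -/
theorem exists_eq_add_finite_range [TopologicalSpace.SeparableSpace H]
    (J : TwoSidedIdeal (H →L[ℂ] H)) (hJ : J ≠ ⊤) {j : H →L[ℂ] H} (hj : j ∈ J) :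
    ∃ a b : H →L[ℂ] H, j = a + b ∧ ‖a‖ < 1 ∧ FiniteDimensional ℂ b.range := by
  obtain ⟨F, R, -, hRc, hAR, hn, hRs, hR1, h1R, hF⟩ :=
    exists_spectral_cut (star j * j) (star_mul_self_nonneg j)
  have hFf : FiniteDimensional ℂ F.range := by
    refine J.finiteDimensional_range_of_mul_eq hJ (K := (R + R) * (star j * j)) ?_ ?_
    · exact J.mul_mem_left _ _ (J.mul_mem_left _ _ hj)
    · rw [mul_assoc]; exact hF.symm
  refine ⟨j * R, j * (1 - R), by noncomm_ring, ?_, ?_⟩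
  -- `(jR)*(jR) = R(j*j - F)`, of norm at most 1/2; the remainder is `j(1 - R) = 2jRF`.
  · have h : ‖j * R‖ * ‖j * R‖ ≤ 1 / 2 := by
      rw [← CStarRing.norm_star_mul_self, star_mul, hRs.star_eq,
        show R * star j * (j * R) = R * ((star j * j) * R) by noncomm_ring, hAR]
      calc _ ≤ ‖R‖ * ‖star j * j - F‖ := norm_mul_le _ _
        _ ≤ 1 * (1 / 2) := by gcongr
        _ = 1 / 2 := one_mul _
    nlinarith [norm_nonneg (j * R)]
  · have : j * (1 - R) = (j * (R + R)) * F := by rw [h1R, mul_assoc]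
    rw [this]
    have h' : ((j * (R + R)) * F).range = F.range.map (j * (R + R)).toLinearMap :=
      LinearMap.range_comp _ _
    rw [h']
    infer_instance

end TwoSidedIdeal

/-! ### Two projections, and part (i). -/

namespace ProjectionPair

open ContinuousLinearMap

variable {H : Type*} [NormedAddCommGroup H] [InnerProductSpace ℂ H]

theorem mem_range_iff {p : H →L[ℂ] H} (hp : IsIdempotentElem p) {x : H} :
    x ∈ p.range ↔ p x = x := by
  refine ⟨?_, fun h => ⟨x, h⟩⟩
  rintro ⟨y, rfl⟩
  exact congrArg (fun T : H →L[ℂ] H => T y) hp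

theorem isClosed_range {p : H →L[ℂ] H} (hp : IsIdempotentElem p) :
    IsClosed (p.range : Set H) := by
  have : (p.range : Set H) = {x | p x = x} := Set.ext fun x => mem_range_iff hp
  rw [this]
  exact isClosed_eq p.continuous continuous_id

variable [CompleteSpace H]

theorem isStarProjection_perp {p : H →L[ℂ] H} (hp : IsStarProjection p) :
    IsStarProjection (perp p) := hp.one_sub

theorem isStarProjection_meet (p q : H →L[ℂ] H) : IsStarProjection (meet p q) :=
  isStarProjection_starProjection

theorem meet_comm (p q : H →L[ℂ] H) : meet p q = meet q p := by
  unfold meet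
  simp only [inf_comm]

theorem range_meet {p q : H →L[ℂ] H} (hp : IsStarProjection p) (hq : IsStarProjection q) :
    (meet p q).range = p.range ⊓ q.range := by
  have hc : IsClosed ((p.range ⊓ q.range : Submodule ℂ H) : Set H) :=
    (isClosed_range hp.1).inter (isClosed_range hq.1)
  have h : (meet p q).range = (p.range ⊓ q.range).topologicalClosure :=
    Submodule.range_starProjection _
  rw [h, hc.submodule_topologicalClosure_eq]

theorem mem_range_meet {p q : H →L[ℂ] H} (hp : IsStarProjection p) (hq : IsStarProjection q)
    {x : H} : x ∈ (meet p q).range ↔ p x = x ∧ q x = x := by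
  rw [range_meet hp hq, Submodule.mem_inf, mem_range_iff hp.1, mem_range_iff hq.1]

theorem meet_apply_eq_self {p q : H →L[ℂ] H} (hp : IsStarProjection p) (hq : IsStarProjection q)
    {x : H} (h1 : p x = x) (h2 : q x = x) : meet p q x = x :=
  (mem_range_iff (isStarProjection_meet p q).1).1 ((mem_range_meet hp hq).2 ⟨h1, h2⟩)

theorem left_mul_meet {p q : H →L[ℂ] H} (hp : IsStarProjection p) (hq : IsStarProjection q) :
    p * meet p q = meet p q :=
  ContinuousLinearMap.ext fun x => ((mem_range_meet hp hq).1 ⟨x, rfl⟩).1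

theorem right_mul_meet {p q : H →L[ℂ] H} (hp : IsStarProjection p) (hq : IsStarProjection q) :
    q * meet p q = meet p q := by
  rw [meet_comm, left_mul_meet hq hp]

theorem meet_mul_left {p q : H →L[ℂ] H} (hp : IsStarProjection p) (hq : IsStarProjection q) :
    meet p q * p = meet p q := by
  have := congrArg star (left_mul_meet hp hq)
  rwa [star_mul, (isStarProjection_meet p q).2.star_eq, hp.2.star_eq] at this

theorem meet_mul_right {p q : H →L[ℂ] H} (hp : IsStarProjection p) (hq : IsStarProjection q) :
    meet p q * q = meet p q := by
  rw [meet_comm, meet_mul_left hq hp]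

section Pair

variable {p q : H →L[ℂ] H} (hp : IsStarProjection p) (hq : IsStarProjection q)
include hp hq

theorem mul_meet_perp : q * meet p (perp q) = 0 := by
  have h := right_mul_meet hp (isStarProjection_perp hq)
  rwa [perp, sub_mul, one_mul, sub_eq_self] at h

theorem meet_perp_mul : meet p (perp q) * q = 0 := by
  have h := meet_mul_right hp (isStarProjection_perp hq)
  rwa [perp, mul_sub, mul_one, sub_eq_self] at h

theorem mul_perp_meet : p * meet (perp p) q = 0 := by
  rw [meet_comm, mul_meet_perp hq hp]

theorem perp_meet_mul : meet (perp p) q * p = 0 := by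
  rw [meet_comm, meet_perp_mul hq hp]

theorem meet_perp_mul_perp_meet : meet p (perp q) * meet (perp p) q = 0 := by
  rw [← meet_mul_left hp (isStarProjection_perp hq), mul_assoc, mul_perp_meet hp hq, mul_zero]

theorem perp_meet_mul_meet_perp : meet (perp p) q * meet p (perp q) = 0 := by
  rw [← meet_mul_right (isStarProjection_perp hp) hq, mul_assoc, mul_meet_perp hp hq, mul_zero]

/-- With `T = p^⊥q - p^⊥ ∧ q`, one finds `p₀^⊥q₀ = T`, and `q₀` differs from `T*` by `qp - p ∧ q`,
which kills `T` since `pT = 0`. -/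
theorem genericSine_radicand :
    genericPart q p * perp (genericPart p q) * genericPart q p =
      star (perp p * q - meet (perp p) q) * (perp p * q - meet (perp p) q) := by
  have hp' := isStarProjection_perp hp
  have hq' := isStarProjection_perp hq
  have e1 : genericPart q p = q - meet p q - meet (perp p) q := by
    rw [genericPart, meet_comm q p, meet_comm q (perp p)]
  rw [e1, genericPart, mul_assoc]
  have pA := left_mul_meet hp hq
  have qA := right_mul_meet hp hq
  have Ap := meet_mul_left hp hq
  have Aq := meet_mul_right hp hq
  have AA : meet p q * meet p q = meet p q := (isStarProjection_meet p q).1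
  have pC := mul_perp_meet hp hq
  have Bq := meet_perp_mul hp hq
  have BC := meet_perp_mul_perp_meet hp hq
  have BA : meet p (perp q) * meet p q = 0 := by rw [← qA, ← mul_assoc, Bq, zero_mul]
  have AC : meet p q * meet (perp p) q = 0 := by rw [← Ap, mul_assoc, pC, mul_zero]
  have sC := (isStarProjection_meet (perp p) q).2.star_eq
  have pp : p * p = p := hp.1
  set A := meet p q
  set B := meet p (perp q)
  set C := meet (perp p) q
  have hX : perp (p - A - B) * (q - A - C) = perp p * q - C := by
    simp only [perp, mul_sub, sub_mul, one_mul, pA, pC, Aq, AA, AC, Bq, BA, BC]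
    abel
  have hpX : p * (perp p * q - C) = 0 := by
    rw [mul_sub, pC, ← mul_assoc, perp, mul_sub, mul_one, pp]; simp
  have hAX : A * (perp p * q - C) = 0 := by rw [← Ap, mul_assoc, hpX, mul_zero]
  rw [hX, star_sub, star_mul, sC, hp'.2.star_eq, hq.2.star_eq]
  have : q - A - C = (q * perp p - C) + q * p - A := by rw [perp, mul_sub, mul_one]; abel
  rw [this, sub_mul, add_mul, hAX, mul_assoc q p, hpX]
  simp

theorem norm_genericSine_apply (x : H) :
    ‖genericSine p q x‖ = ‖(perp p * q - meet (perp p) q) x‖ := by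
  refine norm_apply_eq_of_star_mul_self_eq ?_ x
  have h : IsSelfAdjoint (genericSine p q) := IsSelfAdjoint.of_nonneg (CFC.sqrt_nonneg _)
  rw [h.star_eq, genericSine, CFC.sqrt_mul_sqrt_self _ ?_, genericSine_radicand hp hq]
  rw [genericSine_radicand hp hq]
  exact star_mul_self_nonneg _

/-- The right-hand side is self-adjoint, whence `(p - q)²` commutes with `q` and, by symmetry, with
`p`. -/
theorem mul_sub_sq : q * (p - q) ^ 2 = q * perp p * q := by
  have hp1 : p * p = p := hp.1
  have hq1 : q * q = q := hq.1
  have hq2 : ∀ x, q * (q * x) = q * x := fun x => by rw [← mul_assoc, hq1]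
  simp only [perp, sq, mul_sub, sub_mul, mul_one, mul_assoc, hp1, hq1, hq2]
  abel

theorem sub_sq_mul : (p - q) ^ 2 * q = q * perp p * q := by
  have hp1 : p * p = p := hp.1
  have hq1 : q * q = q := hq.1
  simp only [perp, sq, mul_sub, sub_mul, mul_one, mul_assoc, hp1, hq1]
  abel

theorem commute_sub_sq_right : Commute ((p - q) ^ 2) q :=
  (sub_sq_mul hp hq).trans (mul_sub_sq hp hq).symm

theorem commute_sub_sq_left : Commute ((p - q) ^ 2) p := by
  have h := commute_sub_sq_right hq hp
  rwa [← neg_sub, neg_sq] at h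

theorem sub_sq_nonneg : 0 ≤ (p - q) ^ 2 := by
  have h : IsSelfAdjoint (p - q) := hp.2.sub hq.2
  have := star_mul_self_nonneg (p - q)
  rwa [h.star_eq, ← sq] at this

theorem mul_one_sub_sub_sq : q * (1 - (p - q) ^ 2) = q * p * q := by
  have hq1 : q * q = q := hq.1
  rw [mul_sub, mul_sub_sq hp hq, perp]
  simp only [mul_sub, sub_mul, mul_one, hq1]
  abel

theorem mul_one_sub_sub_sq' : p * (1 - (p - q) ^ 2) = p * q * p := by
  rw [← neg_sub q p, neg_sq, mul_one_sub_sub_sq hq hp]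

variable [TopologicalSpace.SeparableSpace H] {J : TwoSidedIdeal (H →L[ℂ] H)} (hJ : J ≠ ⊤)
include hJ

/-- If `q (p - q)²` lies in a proper ideal, the part `F` of `(p - q)²` above `1/2` is of finite
rank on the range of `q`, and `1 - (p - q)² + F` is invertible. -/
theorem exists_cut (h : q * (p - q) ^ 2 ∈ J) :
    ∃ F N : H →L[ℂ] H, Commute F p ∧ Commute F q ∧ Commute N p ∧ Commute N q ∧
      (1 - (p - q) ^ 2 + F) * N = 1 ∧ N * (1 - (p - q) ^ 2 + F) = 1 ∧
      (∃ K, F = K * (p - q) ^ 2 * F) ∧ FiniteDimensional ℂ (q * F).range := by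
  obtain ⟨F, R, hFc, hRc, -, hn, -, -, -, hF⟩ := exists_spectral_cut _ (sub_sq_nonneg hp hq)
  have cp := commute_sub_sq_left hp hq
  have cq := commute_sub_sq_right hp hq
  have hu : IsUnit (1 - (p - q) ^ 2 + F) := by
    have : 1 - (p - q) ^ 2 + F = 1 - ((p - q) ^ 2 - F) := by abel
    rw [this]
    exact isUnit_one_sub_of_norm_lt_one (hn.trans_lt (by norm_num))
  obtain ⟨u, hu'⟩ := hu
  have cu : ∀ b, Commute ((p - q) ^ 2) b → Commute (↑u⁻¹ : H →L[ℂ] H) b := fun b hb => by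
    refine Commute.units_inv_left ?_
    rw [hu']
    exact ((Commute.one_left b).sub_left hb).add_left (hFc b hb)
  refine ⟨F, ↑u⁻¹, hFc p cp, hFc q cq, cu p cp, cu q cq, ?_, ?_, ⟨R + R, by rwa [mul_assoc]⟩, ?_⟩
  · rw [← hu', Units.mul_inv]
  · rw [← hu', Units.inv_mul]
  -- From `F = 2R(p - q)²F` and commutation with `q`, this element of `J` fixes `qF`. Only `q(p -
  -- q)²` is assumed in `J`, because part (i) provides no more at this stage.
  · refine J.finiteDimensional_range_of_mul_eq hJ (K := (R + R) * (q * (p - q) ^ 2))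
      (J.mul_mem_left _ _ h) ?_
    have hRq : (R + R) * q = q * (R + R) := ((hRc q cq).add_left (hRc q cq))
    have hq1 : q * q = q := hq.1
    have hDq : (p - q) ^ 2 * q = q * (p - q) ^ 2 := cq
    calc (R + R) * (q * (p - q) ^ 2) * (q * F) = (R + R) * q * (((p - q) ^ 2 * q) * F) := by
          noncomm_ring
      _ = q * (R + R) * ((q * (p - q) ^ 2) * F) := by rw [hRq, hDq]
      _ = q * ((R + R) * q) * ((p - q) ^ 2 * F) := by simp only [mul_assoc]
      _ = (q * q) * ((R + R) * ((p - q) ^ 2 * F)) := by rw [hRq]; simp only [mul_assoc]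
      _ = q * F := by rw [hq1, ← hF]

theorem isFiniteProj_meet_perp (h : p - q ∈ J) : IsFiniteProj (meet p (perp q)) := by
  refine J.finiteDimensional_range_of_mul_eq hJ h ?_
  rw [sub_mul, left_mul_meet hp (isStarProjection_perp hq), mul_meet_perp hp hq, sub_zero]

theorem isFiniteProj_perp_meet (h : p - q ∈ J) : IsFiniteProj (meet (perp p) q) := by
  rw [meet_comm]
  refine isFiniteProj_meet_perp hq hp hJ ?_
  rw [← neg_sub]
  exact J.neg_mem h

variable (hJ0 : J ≠ ⊥)
include hJ0

/-- The sine controls only `p^⊥q`; this transfers membership to `pq^⊥`, the finiteness of `p ∧ q^⊥`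
being the only extra input about that side. -/
theorem mul_perp_mem (h : perp p * q ∈ J) (hB : IsFiniteProj (meet p (perp q))) :
    p * perp q ∈ J := by
  have hq' := isStarProjection_perp hq
  have hp' := isStarProjection_perp hp
  have h' : q * perp p ∈ J := by
    have := J.star_mem_of_mem h
    rwa [star_mul, hp'.2.star_eq, hq.2.star_eq] at this
  have hqD : q * (p - q) ^ 2 ∈ J := by
    rw [mul_sub_sq hp hq]
    exact J.mul_mem_right _ _ h'
  obtain ⟨F, N, cFp, cFq, -, -, hN, -, -, hfin⟩ := exists_cut hp hq hJ hqD
  have h1 : p * perp q * (1 - (p - q) ^ 2) ∈ J := by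
    have e : p * perp q * (1 - (p - q) ^ 2) = -(p * (q * perp p) * perp q) := by
      have e1 := mul_one_sub_sub_sq hp' hq'
      have e2 : perp p - perp q = -(p - q) := by simp only [perp]; abel
      have hp1 : p * p = p := hp.1
      rw [e2, neg_sq] at e1
      rw [mul_assoc, e1]
      have e3 : p * (perp q * perp p) = - (p * (q * perp p)) := by
        simp only [perp, mul_sub, sub_mul, mul_one, one_mul, hp1]; abel
      rw [← mul_assoc, e3, neg_mul]
    rw [e]
    exact J.neg_mem (J.mul_mem_right _ _ (J.mul_mem_left _ _ h'))
  -- `q` maps the range of `pq^⊥F` into the finite-dimensional range of `qF`, and the part of that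
  -- range killed by `q` lies in `p ∧ q^⊥`.
  have h2 : p * perp q * F ∈ J := by
    refine J.mem_of_finite_range hJ0 ?_
    have hkey : q * (p * perp q * F) = (q * F) * (p * perp q) := by
      have c : Commute F (p * perp q) := cFp.mul_right ((Commute.one_right F).sub_right cFq)
      rw [← c.eq, ← mul_assoc]
    rw [← Submodule.fg_iff_finiteDimensional]
    refine Submodule.fg_of_fg_map_of_fg_inf_ker q.toLinearMap ?_ ?_
    · rw [Submodule.fg_iff_finiteDimensional]
      refine Submodule.finiteDimensional_of_le (S₂ := (q * F).range) ?_
      rintro _ ⟨_, ⟨x, rfl⟩, rfl⟩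
      exact ⟨p (perp q x), (congrArg (fun T : H →L[ℂ] H => T x) hkey).symm⟩
    · rw [Submodule.fg_iff_finiteDimensional]
      have : FiniteDimensional ℂ (meet p (perp q)).range := hB
      refine Submodule.finiteDimensional_of_le (S₂ := (meet p (perp q)).range) ?_
      rintro z ⟨⟨x, rfl⟩, hz⟩
      refine (mem_range_meet hp hq').2 ⟨(mem_range_iff hp.1).1 ⟨perp q (F x), rfl⟩, ?_⟩
      have hz' : q ((p * perp q * F) x) = 0 := hz
      change (p * perp q * F) x - q ((p * perp q * F) x) = _
      rw [hz', sub_zero]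
      rfl
  have : p * perp q = p * perp q * (1 - (p - q) ^ 2) * N + p * perp q * F * N := by
    rw [← add_mul, ← mul_add, mul_assoc, hN, mul_one]
  rw [this]
  exact J.add_mem (J.mul_mem_right _ _ h1) (J.mul_mem_right _ _ h2)

theorem sub_mem_iff :
    p - q ∈ J ↔ IsFiniteProj (meet (perp p) q) ∧ IsFiniteProj (meet p (perp q)) ∧
      genericSine p q ∈ J := by
  have hq1 : q * q = q := hq.1
  have hX : genericSine p q ∈ J ↔ perp p * q - meet (perp p) q ∈ J :=
    ⟨fun h => J.mem_of_norm_le h fun x => (norm_genericSine_apply hp hq x).ge,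
      fun h => J.mem_of_norm_le h fun x => (norm_genericSine_apply hp hq x).le⟩
  rw [hX]
  constructor
  · intro h
    have hC := isFiniteProj_perp_meet hp hq hJ h
    refine ⟨hC, isFiniteProj_meet_perp hp hq hJ h, ?_⟩
    have e : perp p * q = -((p - q) * q) := by
      rw [perp, sub_mul, sub_mul, one_mul, hq1, neg_sub]
    rw [e]
    exact J.sub_mem (J.neg_mem (J.mul_mem_right _ _ h)) (J.mem_of_finite_range hJ0 hC)
  · rintro ⟨hC, hB, h⟩
    have h1 : perp p * q ∈ J := by
      have := J.add_mem h (J.mem_of_finite_range hJ0 hC)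
      rwa [sub_add_cancel] at this
    have h2 := mul_perp_mem hp hq hJ hJ0 h1 hB
    have e : p - q = p * perp q - perp p * q := by
      simp only [perp, mul_sub, sub_mul, mul_one, one_mul]; abel
    rw [e]
    exact J.sub_mem h2 h1

end Pair

end ProjectionPair

/-! ### Fredholmness and the index formula. -/

/-- A map into a subspace whose values lie in a finite-dimensional subspace has finite rank. -/
theorem LinearMap.finiteDimensional_range_of_forall_mem {k M E : Type*} [Field k] [AddCommGroup M]
    [Module k M] [AddCommGroup E] [Module k E] {S : Submodule k E} (g : M →ₗ[k] S)
    (U : Submodule k E) [FiniteDimensional k U] (h : ∀ x, (g x : E) ∈ U) :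
    FiniteDimensional k g.range := by
  have : FiniteDimensional k (g.range.map S.subtype) := by
    refine Submodule.finiteDimensional_of_le (S₂ := U) ?_
    rintro _ ⟨_, ⟨x, rfl⟩, rfl⟩
    exact h x
  exact Module.Finite.equiv
    (Submodule.equivMapOfInjective S.subtype S.injective_subtype g.range).symm

namespace ProjectionPair

open ContinuousLinearMap

variable {H : Type*} [NormedAddCommGroup H] [InnerProductSpace ℂ H] [CompleteSpace H]
  {p q : H →L[ℂ] H} (hp : IsStarProjection p) (hq : IsStarProjection q)
include hp hq

theorem finrank_ker_restr :
    Module.finrank ℂ (restr p q).ker = Module.finrank ℂ (meet p (perp q)).range := by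
  have : (restr p q).ker.map p.range.subtype = (meet p (perp q)).range := by
    ext x
    rw [mem_range_meet hp (isStarProjection_perp hq), ← mem_range_iff hp.1, perp]
    constructor
    · rintro ⟨⟨y, hy⟩, hy', rfl⟩
      have h : q y = 0 := congrArg Subtype.val hy'
      exact ⟨hy, by simp [h]⟩
    · rintro ⟨h1, h2⟩
      have h : q x = 0 := by simpa using h2
      exact ⟨⟨x, h1⟩, Subtype.ext h, rfl⟩
  rw [← this]
  exact (Submodule.equivMapOfInjective p.range.subtype p.range.injective_subtype _).finrank_eq

/-- Closedness identifies the cokernel with the orthogonal complement of the range in `qH`; for `y`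
there, `0 = ⟪qpy, y⟫ = ‖py‖²`. -/
theorem finrank_coker_restr (hc : IsClosed ((restr p q).range : Set q.range)) :
    Module.finrank ℂ (q.range ⧸ (restr p q).range) =
      Module.finrank ℂ (meet (perp p) q).range := by
  have hcomp : CompleteSpace q.range := (isClosed_range hq.1).completeSpace_coe
  have hcomp' : CompleteSpace (restr p q).range := hc.completeSpace_coe
  have hqs : ∀ x y, ⟪q x, y⟫_ℂ = ⟪x, q y⟫_ℂ := fun x y => by
    rw [← adjoint_inner_right, ← star_eq_adjoint, hq.2.star_eq]
  have hps : ∀ x y, ⟪p x, y⟫_ℂ = ⟪x, p y⟫_ℂ := fun x y => by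
    rw [← adjoint_inner_right, ← star_eq_adjoint, hp.2.star_eq]
  have : (restr p q).rangeᗮ.map q.range.subtype = (meet (perp p) q).range := by
    ext y
    rw [mem_range_meet (isStarProjection_perp hp) hq, ← mem_range_iff hq.1, perp]
    constructor
    · rintro ⟨⟨y, hy⟩, hy', rfl⟩
      have hqy : q y = y := (mem_range_iff hq.1).1 hy
      refine ⟨?_, hy⟩
      have h : ⟪q (p y), y⟫_ℂ = 0 :=
        (Submodule.mem_orthogonal _ _).1 hy' _ ⟨⟨p y, y, rfl⟩, rfl⟩
      have hpp : p (p y) = p y := congrArg (fun T : H →L[ℂ] H => T y) hp.1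
      rw [hqs, hqy, ← hpp, hps, inner_self_eq_zero] at h
      simp [h]
    · rintro ⟨h1, h2⟩
      have h : p y = 0 := by simpa using h1
      refine ⟨⟨y, h2⟩, ?_, rfl⟩
      refine (Submodule.mem_orthogonal _ _).2 ?_
      rintro _ ⟨⟨x, hx⟩, rfl⟩
      change ⟪q x, y⟫_ℂ = 0
      rw [hqs, (mem_range_iff hq.1).1 h2, ← (mem_range_iff hp.1).1 hx, hps, h, inner_zero_right]
  rw [← this, ← (Submodule.equivMapOfInjective q.range.subtype q.range.injective_subtype
    _).finrank_eq]
  exact (Submodule.quotientEquivOfIsCompl _ _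
    (Submodule.isCompl_orthogonal _)).finrank_eq

theorem essCodim_eq (h : IsFredholmPair p q) :
    essCodim p q = Module.finrank ℂ (meet p (perp q)).range -
      Module.finrank ℂ (meet (perp p) q).range := by
  rw [← finrank_ker_restr hp hq, ← finrank_coker_restr hp hq h.isClosed_range]
  rfl

variable [TopologicalSpace.SeparableSpace H] {J : TwoSidedIdeal (H →L[ℂ] H)} (hJ : J ≠ ⊤)
include hJ

theorem exists_finite_range_cut (h : p - q ∈ J) :
    ∃ F N : H →L[ℂ] H, Commute F p ∧ Commute F q ∧ Commute N p ∧ Commute N q ∧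
      (1 - (p - q) ^ 2 + F) * N = 1 ∧ N * (1 - (p - q) ^ 2 + F) = 1 ∧
      FiniteDimensional ℂ F.range := by
  have hD : (p - q) ^ 2 ∈ J := by rw [sq]; exact J.mul_mem_left _ _ h
  obtain ⟨F, N, h1, h2, h3, h4, h5, h6, ⟨K, hK⟩, -⟩ :=
    exists_cut hp hq hJ (J.mul_mem_left _ _ hD)
  exact ⟨F, N, h1, h2, h3, h4, h5, h6,
    J.finiteDimensional_range_of_mul_eq hJ (J.mul_mem_left K _ hD) hK.symm⟩

/-- Since `N(1 - (p - q)²) = 1 - NF` and `pqp = p(1 - (p - q)²)`, compressing `N` to a map `qH → pH`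
gives a two-sided inverse modulo finite rank. -/
theorem isFredholmPair_of_sub_mem (h : p - q ∈ J) : IsFredholmPair p q := by
  obtain ⟨F, N, -, -, cNp, cNq, -, hN, hfin⟩ := exists_finite_range_cut hp hq hJ h
  have hN' : N * (1 - (p - q) ^ 2) = 1 - N * F := by
    rw [mul_add] at hN; exact eq_sub_of_add_eq hN
  let v : q.range →L[ℂ] p.range :=
    ((p * N).comp q.range.subtypeL).codRestrict p.range (fun x => ⟨N x, rfl⟩)
  have key1 : p * N * q * p = p - p * (N * F) := by
    calc p * N * q * p = N * (p * q * p) := by rw [← cNp.eq]; simp only [mul_assoc]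
      _ = p * (N * (1 - (p - q) ^ 2)) := by rw [← mul_one_sub_sub_sq' hp hq, ← mul_assoc, ← mul_assoc, cNp.eq]
      _ = _ := by rw [hN', mul_sub, mul_one]
  have key2 : q * p * N * q = q - q * (N * F) := by
    calc q * p * N * q = (q * p) * (N * q) := by simp only [mul_assoc]
      _ = N * (q * p * q) := by
        rw [cNq.eq, ← mul_assoc, mul_assoc q p q, mul_assoc q, mul_assoc p, ← cNq.eq,
          ← mul_assoc p, ← cNp.eq, mul_assoc N, ← mul_assoc q N, ← cNq.eq, mul_assoc]
      _ = q * (N * (1 - (p - q) ^ 2)) := by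
        rw [← mul_one_sub_sub_sq hp hq, ← mul_assoc, ← mul_assoc, cNq.eq]
      _ = _ := by rw [hN', mul_sub, mul_one]
  have fin : ∀ b : H →L[ℂ] H, FiniteDimensional ℂ (b * (N * F)).range := fun b => by
    have : (b * (N * F)).range = F.range.map (b * N).toLinearMap := by
      rw [← mul_assoc]; exact LinearMap.range_comp _ _
    rw [this]; infer_instance
  refine IsFredholm.of_isQuasiInverse (v := v) ⟨?_, ?_⟩
  · refine LinearMap.FiniteRangeSetoid.equiv_iff_hasFiniteRange.2 ?_
    rw [LinearMap.hasFiniteRange_iff_range]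
    have := fin p
    refine (Submodule.fg_iff_finiteDimensional _).2
      (LinearMap.finiteDimensional_range_of_forall_mem _ (p * (N * F)).range fun x => ?_)
    refine ⟨-x, ?_⟩
    have hx : p x = x := (mem_range_iff hp.1).1 x.2
    have hk := congrArg (fun T : H →L[ℂ] H => T x) key1
    have hk' : p (N (q (p x))) = p x - p (N (F x)) := hk
    rw [hx] at hk'
    change p (N (F (-x))) = p (N (q x)) - x
    rw [hk', map_neg, map_neg, map_neg]
    abel
  · refine LinearMap.FiniteRangeSetoid.equiv_iff_hasFiniteRange.2 ?_
    rw [LinearMap.hasFiniteRange_iff_range]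
    have := fin q
    refine (Submodule.fg_iff_finiteDimensional _).2
      (LinearMap.finiteDimensional_range_of_forall_mem _ (q * (N * F)).range fun x => ?_)
    refine ⟨-x, ?_⟩
    have hx : q x = x := (mem_range_iff hq.1).1 x.2
    have hk := congrArg (fun T : H →L[ℂ] H => T x) key2
    have hk' : q (p (N (q x))) = q x - q (N (F x)) := hk
    rw [hx] at hk'
    change q (N (F (-x))) = q (p (N x)) - x
    rw [hk', map_neg, map_neg, map_neg]
    abel

end ProjectionPair

/-! ### Unitary parts of normal invertibles in `1 + J`. -/

theorem TwoSidedIdeal.exists_unitary_of_abs {A : Type*} [Ring A] [StarRing A]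
    (J : TwoSidedIdeal A) {Y c p q : A} (hn : Y * star Y = star Y * Y) (hcs : IsSelfAdjoint c)
    (hcc : c * c = star Y * Y) (hcu : IsUnit c) (h1 : IsUnit (1 + c)) (hY : Y - 1 ∈ J)
    (hZ : star Y * Y - 1 ∈ J) (hcY : Commute c Y) (hcq : Commute c q) (hpq : Y * q = p * Y) :
    ∃ u ∈ unitary A, u - 1 ∈ J ∧ p = u * q * star u := by
  obtain ⟨d, hd⟩ := h1
  obtain ⟨k, hk⟩ := hcu
  obtain ⟨l, hl⟩ : ∃ l : A, l = ↑k⁻¹ := ⟨_, rfl⟩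
  have hkY : Commute l Y := hl ▸ Commute.units_inv_left (by rwa [hk])
  have hkq : Commute l q := hl ▸ Commute.units_inv_left (by rwa [hk])
  have hkc : l * c = 1 := by rw [hl, ← hk, Units.inv_mul]
  have hck : c * l = 1 := by rw [hl, ← hk, Units.mul_inv]
  have hks : star l = l := by
    have e : c * star l = 1 := by
      rw [← hcs.star_eq, ← star_mul, hkc, star_one]
    rw [← one_mul (star l), ← hkc, mul_assoc, e, mul_one]
  -- `J` need not be closed, so `|Y| - 1` is exhibited as an explicit multiple: `c - 1 = (1 +
  -- c)⁻¹(Y*Y - 1)`.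
  have hc1 : c - 1 ∈ J := by
    have : c - 1 = ↑d⁻¹ * (star Y * Y - 1) := by
      rw [← hcc, show c * c - 1 = (1 + c) * (c - 1) by noncomm_ring, ← hd, ← mul_assoc,
        Units.inv_mul, one_mul]
    rw [this]
    exact J.mul_mem_left _ _ hZ
  have hkYs : l * star Y = star Y * l := by
    have := congrArg star hkY.eq
    rw [star_mul, star_mul, hks] at this
    exact this.symm
  have hu1 : star (Y * l) * (Y * l) = 1 := by
    calc star (Y * l) * (Y * l) = l * (star Y * Y) * l := by
          rw [star_mul, hks]; simp only [mul_assoc]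
      _ = (l * c) * (c * l) := by rw [← hcc]; simp only [mul_assoc]
      _ = 1 := by rw [hkc, hck, mul_one]
  have hu2 : (Y * l) * star (Y * l) = 1 := by
    calc Y * l * star (Y * l) = (l * Y) * (star Y * l) := by
          rw [star_mul, hks, hkY.eq, hkYs]
      _ = l * (Y * star Y) * l := by simp only [mul_assoc]
      _ = (l * c) * (c * l) := by rw [hn, ← hcc]; simp only [mul_assoc]
      _ = 1 := by rw [hkc, hck, mul_one]
  refine ⟨Y * l, Unitary.mem_iff.2 ⟨hu1, hu2⟩, ?_, ?_⟩
  · have : Y * l - 1 = ((Y - 1) - (c - 1)) * l := by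
      rw [sub_sub_sub_cancel_right, sub_mul, hck]
    rw [this]
    exact J.mul_mem_right _ _ (J.sub_mem hY hc1)
  · have : Y * l * q = p * (Y * l) := by
      rw [mul_assoc, hkq.eq, ← mul_assoc, hpq, mul_assoc]
    rw [this, mul_assoc, hu2, mul_one]

namespace ContinuousLinearMap

variable {H : Type*} [NormedAddCommGroup H] [InnerProductSpace ℂ H] [CompleteSpace H]

/-- An injective finite rank perturbation of an invertible operator is invertible. -/
theorem isUnit_add_of_finite_range {e b N : H →L[ℂ] H} (h1 : e * N = 1) (h2 : N * e = 1)
    (hb : FiniteDimensional ℂ b.range) (hinj : ∀ x, (e + b) x = 0 → x = 0) : IsUnit (e + b) := by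
  have hfin : FiniteDimensional ℂ (N * b).range := by
    have : (N * b).range = b.range.map N.toLinearMap := LinearMap.range_comp _ _
    rw [this]; infer_instance
  obtain ⟨-, hc, hi⟩ := LinearMap.index_id_add_of_finite_range (N * b).toLinearMap hfin
  have hfun : ∀ x, (LinearMap.id + (N * b).toLinearMap : H →ₗ[ℂ] H) x = N ((e + b) x) := fun x => by
    have : N (e x) = x := congrArg (fun T : H →L[ℂ] H => T x) h2
    simp [this]
  have hNe : ∀ y, e (N y) = y := fun y => congrArg (fun T : H →L[ℂ] H => T y) h1
  have hker : (LinearMap.id + (N * b).toLinearMap).ker = ⊥ := by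
    refine (Submodule.eq_bot_iff _).2 fun x hx => hinj x ?_
    have hx' : N ((e + b) x) = 0 := by rw [← hfun]; exact hx
    rw [← hNe ((e + b) x), hx', map_zero]
  rw [LinearMap.index_eq_finrank_sub, hker, finrank_bot] at hi
  have hz : Module.finrank ℂ (H ⧸ (LinearMap.id + (N * b).toLinearMap).range) = 0 := by
    omega
  -- `finrank` also vanishes in infinite dimension; `hc` rules this out, so injectivity and index
  -- zero yield surjectivity.
  have hsub := Module.finrank_zero_iff.1 hz
  have htop := Submodule.Quotient.subsingleton_iff.1 hsub
  refine isUnit_iff_bijective.2 ⟨?_, ?_⟩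
  · exact (injective_iff_map_eq_zero (e + b)).2 hinj
  · intro y
    obtain ⟨x, hx⟩ := LinearMap.range_eq_top.1 htop (N y)
    rw [hfun] at hx
    exact ⟨x, by rw [← hNe ((e + b) x), hx, hNe]⟩

theorem apply_eq_zero_of_star_mul_self_apply {T : H →L[ℂ] H} {x : H}
    (h : (star T * T) x = 0) : T x = 0 := by
  have h' := apply_norm_sq_eq_inner_adjoint_right T x
  have h2 : (adjoint T ∘L T) x = 0 := h
  rw [h2, inner_zero_right, map_zero] at h'
  exact norm_eq_zero.1 (pow_eq_zero_iff two_ne_zero |>.1 h')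

/-- A normal invertible `Y` with `Y - 1` and `Y*Y - 1` in an ideal has its unitary part
`u = Y |Y|⁻¹` in `1 + J`; moreover `u` intertwines whatever `Y` intertwines with a projection
commuting with `Y*Y`. -/
theorem exists_unitary_of_normal (J : TwoSidedIdeal (H →L[ℂ] H)) {Y p q : H →L[ℂ] H}
    (hn : Y * star Y = star Y * Y) (hu : IsUnit (star Y * Y)) (hY : Y - 1 ∈ J)
    (hZ : star Y * Y - 1 ∈ J) (hq : Commute (star Y * Y) q) (hpq : Y * q = p * Y) :
    ∃ u ∈ unitary (H →L[ℂ] H), u - 1 ∈ J ∧ p = u * q * star u := by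
  have hc0 : 0 ≤ CFC.sqrt (star Y * Y) := CFC.sqrt_nonneg _
  have hcc : CFC.sqrt (star Y * Y) * CFC.sqrt (star Y * Y) = star Y * Y :=
    CFC.sqrt_mul_sqrt_self _ (star_mul_self_nonneg Y)
  refine J.exists_unitary_of_abs hn (IsSelfAdjoint.of_nonneg hc0) hcc ?_ ?_ hY hZ ?_ ?_ hpq
  · exact (CFC.isUnit_sqrt_iff _ (star_mul_self_nonneg Y)).2 hu
  · exact (isStrictlyPositive_one.add_nonneg hc0).isUnit
  · rw [CFC.sqrt_eq_cfc]
    refine Commute.cfc_nnreal ?_ _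
    change star Y * Y * Y = Y * (star Y * Y)
    rw [← mul_assoc Y, hn]
  · rw [CFC.sqrt_eq_cfc]
    exact hq.cfc_nnreal _

omit [CompleteSpace H] in
theorem mul_apply_eq_zero (S : H →L[ℂ] H) {T : H →L[ℂ] H} {x : H} (h : T x = 0) :
    (S * T) x = 0 := by
  change S (T x) = 0
  rw [h, map_zero]

/-- Projections of equal finite rank are equivalent. -/
theorem exists_partial_isometry {P Q : H →L[ℂ] H} (hP : IsStarProjection P)
    (hQ : IsStarProjection Q) (hPf : FiniteDimensional ℂ P.range)
    (hQf : FiniteDimensional ℂ Q.range)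
    (h : Module.finrank ℂ P.range = Module.finrank ℂ Q.range) :
    ∃ W : H →L[ℂ] H, star W * W = P ∧ W * star W = Q ∧ W * P = W ∧ Q * W = W := by
  obtain ⟨_, hP'⟩ := isStarProjection_iff_eq_starProjection_range.1 hP
  obtain ⟨_, hQ'⟩ := isStarProjection_iff_eq_starProjection_range.1 hQ
  generalize P.range = U at *
  generalize Q.range = V at *
  subst hP' hQ'
  let φ : U ≃ₗᵢ[ℂ] V :=
    (stdOrthonormalBasis ℂ U).equiv (stdOrthonormalBasis ℂ V) (finCongr h)
  let W : H →L[ℂ] H := V.subtypeL ∘L (φ : U →L[ℂ] V) ∘L U.orthogonalProjectionOnto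
  let W' : H →L[ℂ] H := U.subtypeL ∘L (φ.symm : V →L[ℂ] U) ∘L V.orthogonalProjectionOnto
  have hW : star W = W' := by
    rw [star_eq_adjoint]
    refine ((eq_adjoint_iff _ _).2 fun x y => ?_).symm
    have h1 : ⟪W' x, y⟫_ℂ =
        ⟪φ.symm (V.orthogonalProjectionOnto x), U.orthogonalProjectionOnto y⟫_ℂ :=
      (Submodule.inner_orthogonalProjectionOnto_eq_of_mem_left _ _).symm
    have h2 : ⟪x, W y⟫_ℂ = ⟪V.orthogonalProjectionOnto x, φ (U.orthogonalProjectionOnto y)⟫_ℂ :=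
      (Submodule.inner_orthogonalProjectionOnto_eq_of_mem_right _ _).symm
    rw [h1, h2, ← φ.inner_map_map, φ.apply_symm_apply]
  have hU : ∀ x : U, U.orthogonalProjectionOnto (x : H) = x :=
    U.orthogonalProjectionOnto_mem_subspace_eq_self
  have hV : ∀ x : V, V.orthogonalProjectionOnto (x : H) = x :=
    V.orthogonalProjectionOnto_mem_subspace_eq_self
  have hWx : ∀ x, W x = φ (U.orthogonalProjectionOnto x) := fun _ => rfl
  have hWx' : ∀ x, W' x = φ.symm (V.orthogonalProjectionOnto x) := fun _ => rfl
  refine ⟨W, ?_, ?_, ?_, ?_⟩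
  · rw [hW]
    ext x
    change W' (W x) = U.orthogonalProjectionOnto x
    rw [hWx, hWx', hV, φ.symm_apply_apply]
  · rw [hW]
    ext x
    change W (W' x) = V.orthogonalProjectionOnto x
    rw [hWx', hWx, hU, φ.apply_symm_apply]
  · ext x
    change W (U.orthogonalProjectionOnto x) = W x
    rw [hWx, hWx, hU]
  · ext x
    change (V.orthogonalProjectionOnto (W x) : H) = W x
    rw [hWx, hV]

end ContinuousLinearMap

/-! ### The intertwiner `X = pq + p^⊥q^⊥`. -/

namespace ProjectionPair

open ContinuousLinearMap

variable {H : Type*} [NormedAddCommGroup H] [InnerProductSpace ℂ H] [CompleteSpace H]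
  {p q : H →L[ℂ] H} (hp : IsStarProjection p) (hq : IsStarProjection q)
include hp hq

theorem star_intertwiner :
    star (p * q + perp p * perp q) = q * p + perp q * perp p := by
  rw [star_add, star_mul, star_mul, hp.2.star_eq, hq.2.star_eq,
    (isStarProjection_perp hp).2.star_eq, (isStarProjection_perp hq).2.star_eq]

/-- This is `X*X`; the value is symmetric in `p` and `q`, so `X` is normal. -/
theorem star_intertwiner_mul_self :
    (q * p + perp q * perp p) * (p * q + perp p * perp q) = 1 - (p - q) ^ 2 := by
  have hp1 : p * p = p := hp.1
  have hq1 : q * q = q := hq.1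
  have hp2 : ∀ x, p * (p * x) = p * x := fun x => by rw [← mul_assoc, hp1]
  simp only [perp, sq, mul_sub, sub_mul, mul_add, add_mul, mul_one, one_mul, mul_assoc, hp1, hq1,
    hp2]
  abel

theorem intertwiner_mul_meet_perp : (p * q + perp p * perp q) * meet p (perp q) = 0 := by
  have hq' := isStarProjection_perp hq
  rw [add_mul, mul_assoc, mul_meet_perp hp hq, mul_assoc, right_mul_meet hp hq', perp, sub_mul,
    left_mul_meet hp hq']
  simp

theorem intertwiner_mul_perp_meet : (p * q + perp p * perp q) * meet (perp p) q = 0 := by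
  have hp' := isStarProjection_perp hp
  rw [add_mul, mul_assoc, right_mul_meet hp' hq, mul_perp_meet hp hq, mul_assoc, perp, perp,
    sub_mul 1 q, ← perp, right_mul_meet hp' hq]
  simp

/-- The operator `1 - (p - q)²` becomes injective after adding the projections onto the two
one-sided non-generic parts. -/
theorem eq_zero_of_apply_eq_zero {x : H}
    (hx : (1 - (p - q) ^ 2 + (meet p (perp q) + meet (perp p) q) : H →L[ℂ] H) x = 0) : x = 0 := by
  have hp' := isStarProjection_perp hp
  have hq' := isStarProjection_perp hq
  have e1 := mul_one_sub_sub_sq' hp hq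
  have e1' := mul_one_sub_sub_sq hp hq
  have e2 := mul_one_sub_sub_sq' hp' hq'
  have e3 : perp p - perp q = -(p - q) := by simp only [perp]; abel
  rw [e3, neg_sq] at e2
  have hB : meet p (perp q) * (1 - (p - q) ^ 2 + (meet p (perp q) + meet (perp p) q)) =
      meet p (perp q) := by
    have h : meet p (perp q) * (1 - (p - q) ^ 2) = 0 := by
      rw [← meet_mul_left hp hq', mul_assoc, e1, ← mul_assoc, ← mul_assoc, meet_mul_left hp hq',
        meet_perp_mul hp hq, zero_mul]
    rw [mul_add, mul_add, h, meet_perp_mul_perp_meet hp hq, (isStarProjection_meet _ _).1.eq]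
    simp
  have hC : meet (perp p) q * (1 - (p - q) ^ 2 + (meet p (perp q) + meet (perp p) q)) =
      meet (perp p) q := by
    have h : meet (perp p) q * (1 - (p - q) ^ 2) = 0 := by
      rw [← meet_mul_right hp' hq, mul_assoc, e1', ← mul_assoc, ← mul_assoc,
        meet_mul_right hp' hq, perp_meet_mul hp hq, zero_mul]
    rw [mul_add, mul_add, h, perp_meet_mul_meet_perp hp hq, (isStarProjection_meet _ _).1.eq]
    simp
  have hBx : meet p (perp q) x = 0 := by
    rw [← hB]; exact mul_apply_eq_zero _ hx
  have hCx : meet (perp p) q x = 0 := by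
    rw [← hC]; exact mul_apply_eq_zero _ hx
  have hDx : (1 - (p - q) ^ 2 : H →L[ℂ] H) x = 0 := by
    rw [add_apply, add_apply, hBx, hCx, add_zero, add_zero] at hx
    exact hx
  -- `(qp)*(qp) = pqp = p(1 - (p - q)²)` kills `x`, so `px` lies in `p ∧ q^⊥`; hence `px` equals `(p
  -- ∧ q^⊥)x = 0`.
  have hqp : (q * p) x = 0 := by
    refine apply_eq_zero_of_star_mul_self_apply ?_
    rw [star_mul, hp.2.star_eq, hq.2.star_eq, mul_assoc, ← mul_assoc q, hq.1.eq, ← mul_assoc, ← e1]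
    exact mul_apply_eq_zero _ hDx
  have hqp' : (perp q * perp p) x = 0 := by
    refine apply_eq_zero_of_star_mul_self_apply ?_
    rw [star_mul, hp'.2.star_eq, hq'.2.star_eq, mul_assoc, ← mul_assoc (perp q), hq'.1.eq,
      ← mul_assoc, ← e2]
    exact mul_apply_eq_zero _ hDx
  have h1 : p x = 0 := by
    have h : meet p (perp q) (p x) = p x := by
      refine meet_apply_eq_self hp hq' ((mem_range_iff hp.1).1 ⟨x, rfl⟩) ?_
      have : q (p x) = 0 := hqp
      simp [perp, this]
    have h' : meet p (perp q) (p x) = meet p (perp q) x :=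
      congrArg (fun T : H →L[ℂ] H => T x) (meet_mul_left hp hq')
    rw [← h, h', hBx]
  have h2 : perp p x = 0 := by
    have h : meet (perp p) q (perp p x) = perp p x := by
      refine meet_apply_eq_self hp' hq ((mem_range_iff hp'.1).1 ⟨x, rfl⟩) ?_
      have h0 : perp p x - q (perp p x) = 0 := hqp'
      exact (sub_eq_zero.1 h0).symm
    have h' : meet (perp p) q (perp p x) = meet (perp p) q x :=
      congrArg (fun T : H →L[ℂ] H => T x) (meet_mul_left hp' hq)
    rw [← h, h', hCx]
  have h3 : x - p x = 0 := h2
  rwa [h1, sub_zero] at h3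

end ProjectionPair

/-- Neumann series: `1 - a` is bijective for a strict contraction `a`. -/
theorem ContinuousLinearMap.bijective_one_sub_of_norm_lt_one {E : Type*} [NormedAddCommGroup E]
    [NormedSpace ℂ E] [CompleteSpace E] {a : E →L[ℂ] E} (ha : ‖a‖ < 1) :
    Function.Bijective (1 - a : E →L[ℂ] E) :=
  isUnit_iff_bijective.1 (isUnit_one_sub_of_norm_lt_one ha)

/-! ### Part (ii): index zero and unitaries in `1 + J`. -/

namespace ProjectionPair

open ContinuousLinearMap

variable {H : Type*} [NormedAddCommGroup H] [InnerProductSpace ℂ H] [CompleteSpace H]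
  [TopologicalSpace.SeparableSpace H]
  {p q : H →L[ℂ] H} (hp : IsStarProjection p) (hq : IsStarProjection q)
  {J : TwoSidedIdeal (H →L[ℂ] H)} (hJ : J ≠ ⊤) (h : p - q ∈ J)
include hp hq hJ h

theorem exists_unitary_of_essCodim_eq_zero (hJ0 : J ≠ ⊥) (h0 : essCodim p q = 0) :
    ∃ u ∈ unitary (H →L[ℂ] H), u - 1 ∈ J ∧ p = u * q * star u := by
  have hp' := isStarProjection_perp hp
  have hq' := isStarProjection_perp hq
  have hBf : FiniteDimensional ℂ (meet p (perp q)).range := isFiniteProj_meet_perp hp hq hJ h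
  have hCf : FiniteDimensional ℂ (meet (perp p) q).range := isFiniteProj_perp_meet hp hq hJ h
  have hBJ := J.mem_of_finite_range hJ0 hBf
  have hCJ := J.mem_of_finite_range hJ0 hCf
  obtain ⟨F, N, -, -, -, -, hN1, hN2, hF⟩ := exists_finite_range_cut hp hq hJ h
  have hD : (p - q) ^ 2 ∈ J := by rw [sq]; exact J.mul_mem_left _ _ h
  rw [essCodim_eq hp hq (isFredholmPair_of_sub_mem hp hq hJ h)] at h0
  -- `X` vanishes on both `B = p ∧ q^⊥` and `C = p^⊥ ∧ q`; index zero gives them equal dimension,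
  -- and `W + W*` swaps them. All cross terms with `X` vanish.
  obtain ⟨W, hW1, hW2, WC, BW⟩ := exists_partial_isometry (isStarProjection_meet (perp p) q)
    (isStarProjection_meet p (perp q)) hCf hBf (by omega)
  have sB := (isStarProjection_meet p (perp q)).2.star_eq
  have sC := (isStarProjection_meet (perp p) q).2.star_eq
  have CW : meet (perp p) q * star W = star W := by
    have := congrArg star WC
    rwa [star_mul, sC] at this
  have WB : star W * meet p (perp q) = star W := by
    have := congrArg star BW
    rwa [star_mul, sB] at this
  have XB := intertwiner_mul_meet_perp hp hq
  have XC := intertwiner_mul_perp_meet hp hq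
  have XB' := intertwiner_mul_perp_meet hq hp
  have XC' := intertwiner_mul_meet_perp hq hp
  rw [meet_comm] at XB' XC'
  have sX := star_intertwiner hp hq
  have XX := star_intertwiner_mul_self hp hq
  have XX' := star_intertwiner_mul_self hq hp
  rw [← neg_sub p q, neg_sq] at XX'
  have BC := meet_perp_mul_perp_meet hp hq
  have CB := perp_meet_mul_meet_perp hp hq
  have hpC := mul_perp_meet hp hq
  have hBq := meet_perp_mul hp hq
  have pB := left_mul_meet hp hq'
  have Cq := meet_mul_right hp' hq
  have hinj := fun x => eq_zero_of_apply_eq_zero hp hq (x := x)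
  set B := meet p (perp q)
  set C := meet (perp p) q
  obtain ⟨X, hX⟩ : ∃ X, X = p * q + perp p * perp q := ⟨_, rfl⟩
  obtain ⟨X', hX'⟩ : ∃ X, X = q * p + perp q * perp p := ⟨_, rfl⟩
  rw [← hX, ← hX'] at sX XX XX'
  rw [← hX] at XB XC
  rw [← hX'] at XB' XC'
  have z1 : W * W = 0 := by
    calc W * W = (W * C) * (B * W) := by rw [WC, BW]
      _ = W * (C * B) * W := by simp only [mul_assoc]
      _ = 0 := by rw [CB, mul_zero, zero_mul]
  have z2 : star W * star W = 0 := by rw [← star_mul, z1, star_zero]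
  have z3 : X * W = 0 := by rw [← BW, ← mul_assoc, XB, zero_mul]
  have z4 : X * star W = 0 := by rw [← CW, ← mul_assoc, XC, zero_mul]
  have z5 : X' * W = 0 := by rw [← BW, ← mul_assoc, XB', zero_mul]
  have z6 : X' * star W = 0 := by rw [← CW, ← mul_assoc, XC', zero_mul]
  have z7 : star W * X' = 0 := by rw [← sX, ← star_mul, z3, star_zero]
  have z8 : W * X' = 0 := by rw [← star_star W, ← sX, ← star_mul, z4, star_zero]
  have sX' : star X' = X := by rw [← sX, star_star]
  have z9 : star W * X = 0 := by rw [← sX', ← star_mul, z5, star_zero]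
  have z10 : W * X = 0 := by rw [← star_star W, ← sX', ← star_mul, z6, star_zero]
  have sY : star (X + (W + star W)) = X' + (W + star W) := by
    rw [star_add, sX, star_add, star_star, add_comm W]
  have YY : star (X + (W + star W)) * (X + (W + star W)) = 1 - (p - q) ^ 2 + (B + C) := by
    rw [sY]
    simp only [mul_add, add_mul, XX, z1, z2, z5, z6, z9, z10, hW1, hW2]
    abel
  have YY' : (X + (W + star W)) * star (X + (W + star W)) = 1 - (p - q) ^ 2 + (B + C) := by
    rw [sY]
    simp only [mul_add, add_mul, XX', z1, z2, z3, z4, z7, z8, hW1, hW2]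
    abel
  have hWJ : W ∈ J := by rw [← BW]; exact J.mul_mem_right _ _ hBJ
  refine exists_unitary_of_normal J (Y := X + (W + star W)) (by rw [YY, YY']) ?_ ?_ ?_ ?_ ?_
  · rw [YY]
    -- An injective finite rank perturbation of the invertible `1 - (p - q)² + F`.
    have e : 1 - (p - q) ^ 2 + (B + C) = (1 - (p - q) ^ 2 + F) + (B + C - F) := by abel
    have hb : FiniteDimensional ℂ (B + C - F).range := by
      refine Submodule.finiteDimensional_of_le (S₂ := B.range ⊔ C.range ⊔ F.range) ?_
      rintro _ ⟨x, rfl⟩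
      exact sub_mem (Submodule.mem_sup_left (add_mem (Submodule.mem_sup_left ⟨x, rfl⟩)
        (Submodule.mem_sup_right ⟨x, rfl⟩))) (Submodule.mem_sup_right ⟨x, rfl⟩)
    rw [e] at hinj ⊢
    exact isUnit_add_of_finite_range hN1 hN2 hb hinj
  · have e : X + (W + star W) - 1 = ((p - q) * q - p * (p - q)) + (W + star W) := by
      rw [hX]
      simp only [perp, mul_sub, sub_mul, mul_one, one_mul, hp.1.eq, hq.1.eq]
      abel
    rw [e]
    exact J.add_mem (J.sub_mem (J.mul_mem_right _ _ h) (J.mul_mem_left _ _ h))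
      (J.add_mem hWJ (J.star_mem_of_mem hWJ))
  · rw [YY, show 1 - (p - q) ^ 2 + (B + C) - 1 = (B + C) - (p - q) ^ 2 by abel]
    exact J.sub_mem (J.add_mem hBJ hCJ) hD
  · rw [YY]
    have qB : q * B = 0 := mul_meet_perp hp hq
    have qC : q * C = C := right_mul_meet hp' hq
    have hBC : Commute (B + C) q := by
      rw [commute_iff_eq, add_mul, mul_add, hBq, Cq, qB, qC]
    exact ((Commute.one_left q).sub_left (commute_sub_sq_right hp hq)).add_left hBC
  · have h1 : X * q = p * X := by
      rw [hX]
      simp only [perp, mul_sub, sub_mul, mul_add, add_mul, mul_one, one_mul, mul_assoc, hq.1.eq]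
      simp only [← mul_assoc, hp.1.eq]
      abel
    have h2 : W * q = p * W := by
      rw [← WC, mul_assoc, Cq, WC, ← BW, ← mul_assoc, pB]
    have h3 : star W * q = 0 := by rw [← WB, mul_assoc, hBq, mul_zero]
    have h4 : p * star W = 0 := by rw [← CW, ← mul_assoc, hpC, zero_mul]
    rw [add_mul, add_mul, mul_add, mul_add, h1, h2, h3, h4]

theorem essCodim_eq_zero_of_unitary {u : H →L[ℂ] H} (hu : u ∈ unitary (H →L[ℂ] H))
    (hu1 : u - 1 ∈ J) (hpu : p = u * q * star u) : essCodim p q = 0 := by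
  obtain ⟨hu2, hu3⟩ := Unitary.mem_iff.1 hu
  have hcomp : CompleteSpace q.range := (isClosed_range hq.1).completeSpace_coe
  have hFr : IsFredholmPair p q := isFredholmPair_of_sub_mem hp hq hJ h
  obtain ⟨a, b, hab, ha, hb⟩ := J.exists_eq_add_finite_range hJ hu1
  have huq : u * q = p * u := by rw [hpu, mul_assoc, hu2, mul_one]
  have hup : star u * p = q * star u := by rw [hpu, ← mul_assoc, ← mul_assoc, hu2, one_mul]
  have hqx : ∀ x : q.range, q (x : H) = x := fun x => (mem_range_iff hq.1).1 x.2
  have hpx : ∀ x : p.range, p (x : H) = x := fun x => (mem_range_iff hp.1).1 x.2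
  have ev : ∀ {S T : H →L[ℂ] H}, S = T → ∀ x, S x = T x := fun h x => by rw [h]
  have hm1 : ∀ x : q.range, u x ∈ p.range := fun x =>
    (mem_range_iff hp.1).2 (by
      have := ev huq (x : H)
      change u (q x) = p (u x) at this
      rw [← this, hqx])
  have hm2 : ∀ x : p.range, star u x ∈ q.range := fun x =>
    (mem_range_iff hq.1).2 (by
      have := ev hup (x : H)
      change star u (p x) = q (star u x) at this
      rw [← this, hpx])
  let e : q.range ≃ₗ[ℂ] p.range := LinearEquiv.ofLinearMap
    ((u.toLinearMap ∘ₗ q.range.subtype).codRestrict p.range hm1)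
    (((star u).toLinearMap ∘ₗ p.range.subtype).codRestrict q.range hm2)
    (LinearMap.ext fun x => Subtype.ext (ev hu3 (x : H)))
    (LinearMap.ext fun x => Subtype.ext (ev hu2 (x : H)))
  let cmp (T : H →L[ℂ] H) : q.range →L[ℂ] q.range :=
    ((q * T).comp q.range.subtypeL).codRestrict q.range fun x => ⟨T x, rfl⟩
  have hq1 : ‖q‖ ≤ 1 := by
    obtain ⟨_, hq'⟩ := isStarProjection_iff_eq_starProjection_range.1 hq
    rw [hq']
    exact Submodule.starProjection_norm_le _
  have hca : ‖cmp (-a)‖ < 1 := by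
    refine lt_of_le_of_lt ?_ ha
    refine opNorm_le_bound _ (norm_nonneg _) fun x => ?_
    change ‖q (-a x)‖ ≤ _
    rw [map_neg, norm_neg]
    calc ‖q (a x)‖ ≤ 1 * ‖a x‖ := q.le_of_opNorm_le hq1 _
      _ ≤ ‖a‖ * ‖x‖ := by rw [one_mul]; exact a.le_opNorm x
  have hbij := bijective_one_sub_of_norm_lt_one hca
  obtain ⟨g, hg⟩ : ∃ g : q.range ≃ₗ[ℂ] q.range, ∀ x, g x = x + cmp a x := by
    refine ⟨LinearEquiv.ofBijective (1 - cmp (-a)).toLinearMap hbij, ?_⟩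
    intro x
    refine Subtype.ext ?_
    change (x : H) - q (-a x) = x + q (a x)
    rw [map_neg, sub_neg_eq_add]
  have hbf : FiniteDimensional ℂ (cmp b).range := by
    have : FiniteDimensional ℂ (q * b).range := by
      have : (q * b).range = b.range.map q.toLinearMap := LinearMap.range_comp _ _
      rw [this]; infer_instance
    exact LinearMap.finiteDimensional_range_of_forall_mem _ (q * b).range fun x => ⟨x, rfl⟩
  -- On `qH`, `qu = (1 + qa) + qb`, where `1 + qa` is invertible by Neumann series and `qb` has
  -- finite rank.
  have hsplit : (restr p q).toLinearMap ∘ₗ e.toLinearMap =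
      g.toLinearMap + (cmp b).toLinearMap := by
    refine LinearMap.ext fun x => Subtype.ext ?_
    change q (u x) = (g x : H) + q (b x)
    rw [hg]
    change q (u x) = ((x : H) + q (a x)) + q (b x)
    have : u (x : H) = x + (a x + b x) := by
      have := ev hab (x : H)
      change u x - x = a x + b x at this
      rw [← this]; abel
    rw [this, map_add, map_add, hqx, add_assoc]
  have hidx := LinearMap.index_equiv_add_of_finite_range g _ hbf
  have := hFr.finite_ker
  have : FiniteDimensional ℂ (q.range ⧸ (restr p q).range) := hFr.finite_coker
  have : FiniteDimensional ℂ e.toLinearMap.ker := by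
    rw [LinearEquiv.ker]; infer_instance
  have : FiniteDimensional ℂ (p.range ⧸ e.toLinearMap.range) := by
    rw [LinearEquiv.range]; infer_instance
  rw [← hsplit, LinearMap.index_comp, LinearEquiv.index_eq_zero, add_zero] at hidx
  exact hidx

end ProjectionPair

theorem mainTheorem5 {H : Type*} [NormedAddCommGroup H] [InnerProductSpace ℂ H]
    [CompleteSpace H] [TopologicalSpace.SeparableSpace H] (hH : ¬ FiniteDimensional ℂ H)
    (J : TwoSidedIdeal (H →L[ℂ] H)) (hJ_ne_bot : J ≠ ⊥) (hJ_ne_top : J ≠ ⊤)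
    (p q : H →L[ℂ] H) (hp : IsStarProjection p) (hq : IsStarProjection q) :
    (p - q ∈ J ↔
      ProjectionPair.IsFiniteProj (ProjectionPair.meet (ProjectionPair.perp p) q) ∧
      ProjectionPair.IsFiniteProj (ProjectionPair.meet p (ProjectionPair.perp q)) ∧
      ProjectionPair.genericSine p q ∈ J) ∧
    (p - q ∈ J →
      ProjectionPair.IsFredholmPair p q ∧
      (ProjectionPair.essCodim p q = 0 ↔
        ∃ u ∈ unitary (H →L[ℂ] H), u - 1 ∈ J ∧ p = u * q * star u)) := by
  refine ⟨ProjectionPair.sub_mem_iff hp hq hJ_ne_top hJ_ne_bot, fun h => ?_⟩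
  refine ⟨ProjectionPair.isFredholmPair_of_sub_mem hp hq hJ_ne_top h, fun h0 => ?_, ?_⟩
  · exact ProjectionPair.exists_unitary_of_essCodim_eq_zero hp hq hJ_ne_top h hJ_ne_bot h0
  · rintro ⟨u, hu, hu1, hpu⟩
    exact ProjectionPair.essCodim_eq_zero_of_unitary hp hq hJ_ne_top h hu hu1 hpu
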